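/- Say that a set of real numbers is $\rho$-separated if any two distinct points of it are at distance at least $\rho$. For $\delta>0$, $u\ge 0$ and $C\ge 1$, say that a finite set $A\subset[0,1]$ is a $(\delta,u)$-set with constant $C$ if $A$ is $\delta$-separated and $|A\cap B(x,r)|\le C\,(r/\delta)^{u}$ for all $x\in\mathbb{R}$ and all $r\ge\delta$, where $B(x,r)$ is the closed ball $[x-r,x+r]$. **Theorem.** For every $s$ with $1/2\le s<2-\sqrt2$ there is a number $\sigma=\sigma(s)<s$ with the following property. For every $C\ge1$ there are $\delta_0>0$ and $c>0$, depending only on $s$ and $C$, such that the following holds for all $0<\delta\le\delta_0$. Let $A\subset[0,1]$ be a $(\delta,1/2)$-set with constant $C$ such that $C^{-1}\delta^{-1/2}\le|A|\le C\delta^{-1/2}$, and let $E\subset[0,1]$ be a set which contains at least $C^{-1}\delta^{-\sigma}$ points that are $C^{-1}\delta^{s}$-separated. Then there is $t\in E$ such that $A+tA=\{a+tb : a,b\in A\}$ contains at least $c\,\delta^{-s}$ points that are $\delta$-separated. -/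

import Mathlib

open scoped Pointwise

/-- A set of reals is `ρ`-separated if distinct points are at distance at least `ρ`. -/
def IsSep (ρ : ℝ) (X : Set ℝ) : Prop :=
  X.Pairwise fun x y => ρ ≤ |x - y|

/-- `X` contains at least `N` points that are `ρ`-separated. -/
def ContainsSep (X : Set ℝ) (ρ N : ℝ) : Prop :=
  ∃ F : Finset ℝ, (F : Set ℝ) ⊆ X ∧ IsSep ρ (F : Set ℝ) ∧ N ≤ (F.card : ℝ)

/-- A finite set `A ⊆ [0,1]` is a `(δ,s)`-set with constant `C` if it is `δ`-separated and
`|A ∩ B(x,r)| ≤ C (r/δ)^s` for all real `x` and all `r ≥ δ`. -/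
structure IsDeltaSet (C δ s : ℝ) (A : Finset ℝ) : Prop where
  subset : (A : Set ℝ) ⊆ Set.Icc 0 1
  sep : IsSep δ (A : Set ℝ)
  nonconc : ∀ x r : ℝ, δ ≤ r →
    (((A : Set ℝ) ∩ Metric.closedBall x r).ncard : ℝ) ≤ C * (r / δ) ^ s

/-! ### Fourier transform of the Gaussian, in real form -/

section GaussianCosine

open MeasureTheory Real

/-! Put `D` = δ^s and `g` = δ^ε with δ = D g^20, let n = |A|, about δ^(-1/2), and let F ⊆ E be the
given separated set. Suppose that for every t in F the set A + tA is covered by fewer than 1/D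
intervals of radius δ. Below, ≲ and ≳ ignore C and powers of log(1/δ).

The tool is `sum_energyCount_le`, an L² bound for the energies of A + tA summed over ℓ-separated t.
The energy is dominated by a Gaussian average of |f(ξ)|²|f(tξ)|², where f is the exponential sum of
A. A large-sieve inequality replaces the sum over t by an integral, at the price of a derivative
term. A Kaufman-type integral bounds the main term; the derivative term is governed by the pairs of
A at distance about w. The bound is used with ℓ = D/C at two scales w.

At w = D g^3, Cauchy–Schwarz gives each t energy at least n^4 D, hence total energy ≳ g n^4, whereas
the main term is only ≲ g^3 n^4. The derivative term must therefore dominate, so the number P of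
pairs of A at distance at most D satisfies P² ≳ n^4 D g^7 (`card_closePairs_lower`): A is clustered
at scale D.

At w = 4D both terms are ≲ n^4, so some t has energy ≲ n^4 D / g (`exists_energyCount_le`). For this
t, Cauchy–Schwarz on triples (a, a', b) with |a - a'| ≤ D, mapped to a' + tb, gives n² P² ≲ D⁻¹ (n^4
D / g) (D/δ)^(1/2), that is, P² ≲ n² g^(-11) (`IsDeltaSet.sq_card_mul_closePairs_le`). But n² ≳ 1/δ
turns the lower bound into P² ≳ n² g^(-13), which is absurd for small δ. -/

lemma integrable_gaussian_mul_of_bounded {b M : ℝ} (hb : 0 < b) {φ : ℝ → ℝ} (hφ : Continuous φ)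
    (hM : ∀ x, |φ x| ≤ M) : Integrable fun x : ℝ => exp (-b * x ^ 2) * φ x := by
  refine Integrable.mul_bdd (c := M) (integrable_exp_neg_mul_sq hb) hφ.aestronglyMeasurable ?_
  exact Filter.Eventually.of_forall hM

lemma integral_gaussian_mul_cos {b : ℝ} (hb : 0 < b) (v : ℝ) :
    ∫ x : ℝ, exp (-b * x ^ 2) * cos (x * v) = √(π / b) * exp (-v ^ 2 / (4 * b)) := by
  have h := fourierIntegral_gaussian (b := (b : ℂ)) (by simpa using hb) (v : ℂ)
  have hre : ∀ x : ℝ, exp (-b * x ^ 2) * cos (x * v) =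
      (Complex.exp (Complex.I * v * x) * Complex.exp (-b * x ^ 2)).re := by
    intro x
    have h1 : Complex.exp (-b * x ^ 2) = ((exp (-b * x ^ 2) : ℝ) : ℂ) := by push_cast; rfl
    have h2 : Complex.I * v * x = ((x * v : ℝ) : ℂ) * Complex.I := by push_cast; ring
    rw [h1, h2, Complex.re_mul_ofReal, Complex.exp_ofReal_mul_I_re]; ring
  have hint : Integrable fun x : ℝ =>
      Complex.exp (Complex.I * v * x) * Complex.exp (-b * x ^ 2) := by
    have h3 : Integrable fun x : ℝ => Complex.exp (-b * x ^ 2) :=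
      integrable_cexp_neg_mul_sq (by simpa using hb)
    refine Integrable.bdd_mul (c := 1) h3 (by fun_prop) ?_
    refine Filter.Eventually.of_forall fun x => ?_
    have h2 : Complex.I * v * x = ((x * v : ℝ) : ℂ) * Complex.I := by push_cast; ring
    rw [h2, Complex.norm_exp_ofReal_mul_I]
  simp_rw [hre]
  have := integral_re hint
  simp only [RCLike.re_to_complex] at this
  rw [this, h]
  have h4 : ((π : ℂ) / b) ^ (1 / 2 : ℂ) = ((√(π / b) : ℝ) : ℂ) := by
    rw [sqrt_eq_rpow, Complex.ofReal_cpow (by positivity)]; push_cast; rfl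
  have h5 : Complex.exp (-(v : ℂ) ^ 2 / (4 * b)) = ((exp (-v ^ 2 / (4 * b)) : ℝ) : ℂ) := by
    push_cast; rfl
  rw [h4, h5, ← Complex.ofReal_mul, Complex.ofReal_re]

end GaussianCosine

/-! ### Exponential sums over A and their Gaussian averages -/

section TrigEnergy

open MeasureTheory Real

/-- The squared modulus of `ξ ↦ ∑ a ∈ A, c a * exp (i ξ a)`, written as a cosine sum. -/
noncomputable def trigEnergy (A : Finset ℝ) (c : ℝ → ℝ) (ξ : ℝ) : ℝ :=
  ∑ p ∈ A ×ˢ A, c p.1 * c p.2 * cos (ξ * (p.1 - p.2))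

variable (A : Finset ℝ) (c : ℝ → ℝ)

lemma trigEnergy_eq_sq_add_sq (ξ : ℝ) : trigEnergy A c ξ =
    (∑ a ∈ A, c a * cos (ξ * a)) ^ 2 + (∑ a ∈ A, c a * sin (ξ * a)) ^ 2 := by
  rw [trigEnergy, sq, sq, Finset.sum_mul_sum, Finset.sum_mul_sum, ← Finset.sum_add_distrib,
    Finset.sum_product]
  refine Finset.sum_congr rfl fun a _ => ?_
  rw [← Finset.sum_add_distrib]
  refine Finset.sum_congr rfl fun b _ => ?_
  rw [mul_sub, cos_sub]; ring

lemma trigEnergy_nonneg (ξ : ℝ) : 0 ≤ trigEnergy A c ξ := by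
  rw [trigEnergy_eq_sq_add_sq]; positivity

@[fun_prop]
lemma continuous_trigEnergy : Continuous (trigEnergy A c) := by
  unfold trigEnergy; fun_prop

lemma trigEnergy_neg (ξ : ℝ) : trigEnergy A c (-ξ) = trigEnergy A c ξ := by
  simp [trigEnergy]

variable {A c}

lemma abs_trigEnergy_le (hc : ∀ a ∈ A, |c a| ≤ 1) (ξ : ℝ) :
    |trigEnergy A c ξ| ≤ (A.card : ℝ) ^ 2 := by
  refine (Finset.abs_sum_le_sum_abs _ _).trans ?_
  have h : ∀ p ∈ A ×ˢ A, |c p.1 * c p.2 * cos (ξ * (p.1 - p.2))| ≤ 1 := by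
    intro p hp
    rw [Finset.mem_product] at hp
    rw [abs_mul, abs_mul]
    exact mul_le_one₀ (mul_le_one₀ (hc _ hp.1) (abs_nonneg _) (hc _ hp.2)) (abs_nonneg _)
      (abs_cos_le_one _)
  refine (Finset.sum_le_sum h).trans ?_
  simp [sq]

lemma integral_gaussian_mul_trigEnergy {b : ℝ} (hb : 0 < b) :
    ∫ ξ : ℝ, exp (-b * ξ ^ 2) * trigEnergy A c ξ =
      √(π / b) * ∑ p ∈ A ×ˢ A, c p.1 * c p.2 * exp (-(p.1 - p.2) ^ 2 / (4 * b)) := by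
  have h : ∀ ξ : ℝ, exp (-b * ξ ^ 2) * trigEnergy A c ξ =
      ∑ p ∈ A ×ˢ A, c p.1 * c p.2 * (exp (-b * ξ ^ 2) * cos (ξ * (p.1 - p.2))) := by
    intro ξ
    rw [trigEnergy, Finset.mul_sum]
    exact Finset.sum_congr rfl fun p _ => by ring
  simp_rw [h]
  rw [integral_finsetSum, Finset.mul_sum]
  · refine Finset.sum_congr rfl fun p _ => ?_
    rw [integral_const_mul, integral_gaussian_mul_cos hb]; ring
  · intro p _
    exact (integrable_gaussian_mul_of_bounded hb (M := 1) (by fun_prop)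
      fun x => abs_cos_le_one _).const_mul _

/-- The Gaussian overlap sum of `A` at scale `w`. -/
noncomputable def gaussianSum (A : Finset ℝ) (w : ℝ) : ℝ :=
  ∑ p ∈ A ×ˢ A, exp (-(p.1 - p.2) ^ 2 / w ^ 2)

lemma gaussianSum_nonneg (A : Finset ℝ) (w : ℝ) : 0 ≤ gaussianSum A w :=
  Finset.sum_nonneg fun _ _ => (exp_pos _).le

lemma integral_gaussian_mul_trigEnergy_le {b w : ℝ} (hb : 0 < b)
    (hbw : 4 * b ≤ w ^ 2) (hc : ∀ a ∈ A, 0 ≤ c a ∧ c a ≤ 1) :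
    ∫ ξ : ℝ, exp (-b * ξ ^ 2) * trigEnergy A c ξ ≤ √(π / b) * gaussianSum A w := by
  rw [integral_gaussian_mul_trigEnergy hb]
  refine mul_le_mul_of_nonneg_left (Finset.sum_le_sum fun p hp => ?_) (sqrt_nonneg _)
  rw [Finset.mem_product] at hp
  have h1 : c p.1 * c p.2 ≤ 1 := mul_le_one₀ (hc _ hp.1).2 (hc _ hp.2).1 (hc _ hp.2).2
  refine (mul_le_of_le_one_left (exp_pos _).le h1).trans ?_
  rw [exp_le_exp, neg_div, neg_div, neg_le_neg_iff]
  exact div_le_div_of_nonneg_left (sq_nonneg _) (by positivity) hbw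

/-- The link from Fourier side to energy: the product of two cosines splits into both signs of t,
and each resulting Gaussian detects |x ± ty| ≲ √b. -/
lemma integral_gaussian_mul_trigEnergy_mul {b : ℝ} (hb : 0 < b) (t : ℝ) :
    ∫ ξ : ℝ, exp (-b * ξ ^ 2) * (trigEnergy A 1 ξ * trigEnergy A 1 (t * ξ)) =
      √(π / b) / 2 * ∑ p ∈ A ×ˢ A, ∑ q ∈ A ×ˢ A,
        (exp (-(p.1 - p.2 + t * (q.1 - q.2)) ^ 2 / (4 * b)) +
          exp (-(p.1 - p.2 - t * (q.1 - q.2)) ^ 2 / (4 * b))) := by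
  have h : ∀ ξ : ℝ, exp (-b * ξ ^ 2) * (trigEnergy A 1 ξ * trigEnergy A 1 (t * ξ)) =
      ∑ p ∈ A ×ˢ A, ∑ q ∈ A ×ˢ A,
        (1 / 2 * (exp (-b * ξ ^ 2) * cos (ξ * (p.1 - p.2 + t * (q.1 - q.2)))) +
        1 / 2 * (exp (-b * ξ ^ 2) * cos (ξ * (p.1 - p.2 - t * (q.1 - q.2))))) := by
    intro ξ
    rw [trigEnergy, trigEnergy, Finset.sum_mul_sum, Finset.mul_sum]
    refine Finset.sum_congr rfl fun p _ => ?_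
    rw [Finset.mul_sum]
    refine Finset.sum_congr rfl fun q _ => ?_
    rw [show ξ * (p.1 - p.2 + t * (q.1 - q.2)) = ξ * (p.1 - p.2) + t * ξ * (q.1 - q.2) by ring,
      show ξ * (p.1 - p.2 - t * (q.1 - q.2)) = ξ * (p.1 - p.2) - t * ξ * (q.1 - q.2) by ring,
      cos_add, cos_sub]
    simp only [Pi.one_apply, one_mul]
    ring
  have hi : ∀ v, Integrable fun ξ : ℝ => 1 / 2 * (exp (-b * ξ ^ 2) * cos (ξ * v)) := fun v =>
    (integrable_gaussian_mul_of_bounded hb (M := 1) (by fun_prop)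
      fun x => abs_cos_le_one _).const_mul _
  have hi2 : ∀ v v', Integrable fun ξ : ℝ => 1 / 2 * (exp (-b * ξ ^ 2) * cos (ξ * v)) +
      1 / 2 * (exp (-b * ξ ^ 2) * cos (ξ * v')) := fun v v' => (hi v).add (hi v')
  simp_rw [h]
  rw [integral_finsetSum _ fun p _ => integrable_finsetSum _ fun q _ => hi2 _ _,
    Finset.mul_sum]
  refine Finset.sum_congr rfl fun p _ => ?_
  rw [integral_finsetSum _ fun q _ => hi2 _ _, Finset.mul_sum]
  refine Finset.sum_congr rfl fun q _ => ?_
  rw [integral_add (hi _) (hi _), integral_const_mul, integral_const_mul,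
    integral_gaussian_mul_cos hb, integral_gaussian_mul_cos hb]
  ring

end TrigEnergy

/-! ### A large-sieve inequality in the dilation parameter -/

section LargeSieve

open MeasureTheory Real

/-- A local Sobolev inequality: a value is at most a mean plus the integral of the derivative. -/
lemma le_mean_add_integral_of_hasDerivAt {u u' v : ℝ → ℝ} (hu : ∀ x, HasDerivAt u (u' x) x)
    (hu' : Continuous u') (hv : Continuous v) (h : ∀ x, |u' x| ≤ v x) (t : ℝ) {ℓ : ℝ}
    (hℓ : 0 < ℓ) :
    u t ≤ ∫ x in t..(t + ℓ), (ℓ⁻¹ * u x + v x) := by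
  have huc : Continuous u := continuous_iff_continuousAt.2 fun x => (hu x).continuousAt
  set V := ∫ x in t..(t + ℓ), v x with hV
  have hpt : ∀ x ∈ Set.Icc t (t + ℓ), u t ≤ u x + V := by
    intro x hx
    have h1 : ∫ y in t..x, u' y = u x - u t :=
      intervalIntegral.integral_eq_sub_of_hasDerivAt (fun y _ => hu y)
        (hu'.intervalIntegrable _ _)
    have h2 : |∫ y in t..x, u' y| ≤ ∫ y in t..x, |u' y| :=
      intervalIntegral.abs_integral_le_integral_abs hx.1
    have h3 : ∫ y in t..x, |u' y| ≤ ∫ y in t..x, v y :=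
      intervalIntegral.integral_mono_on hx.1 (hu'.abs.intervalIntegrable _ _)
        (hv.intervalIntegrable _ _) fun y _ => h y
    have h4 : ∫ y in t..x, v y ≤ V := by
      refine intervalIntegral.integral_mono_interval le_rfl hx.1 hx.2 ?_
        (hv.intervalIntegrable _ _)
      exact Filter.Eventually.of_forall fun y => (abs_nonneg _).trans (h y)
    rw [h1] at h2
    have := neg_abs_le (u x - u t)
    linarith
  have hint : ∫ x in t..(t + ℓ), u t ≤ ∫ x in t..(t + ℓ), (u x + V) :=
    intervalIntegral.integral_mono_on (by linarith) (by simp)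
      ((huc.add continuous_const).intervalIntegrable _ _) hpt
  rw [intervalIntegral.integral_add (huc.intervalIntegrable _ _) (by simp),
    intervalIntegral.integral_const, intervalIntegral.integral_const] at hint
  rw [intervalIntegral.integral_add ((huc.const_mul _).intervalIntegrable _ _)
    (hv.intervalIntegrable _ _), intervalIntegral.integral_const_mul, ← hV]
  simp only [add_sub_cancel_left, smul_eq_mul] at hint
  rw [← mul_le_mul_iff_right₀ hℓ, mul_add, ← mul_assoc, mul_inv_cancel₀ hℓ.ne', one_mul]
  exact hint

/-- Separation makes the intervals (t, t + ℓ] disjoint, and t, ℓ ≤ 1 places them in (0, 2]. -/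
lemma sum_integral_le_integral_of_isSep {v : ℝ → ℝ} (hv : Continuous v) (hv0 : ∀ x, 0 ≤ v x)
    {F : Finset ℝ} {ℓ : ℝ} (hℓ : 0 < ℓ) (hℓ1 : ℓ ≤ 1) (hF : (F : Set ℝ) ⊆ Set.Icc 0 1)
    (hsep : IsSep ℓ (F : Set ℝ)) :
    ∑ t ∈ F, ∫ x in t..(t + ℓ), v x ≤ ∫ x in (0 : ℝ)..2, v x := by
  have h1 : ∀ t ∈ F, ∫ x in t..(t + ℓ), v x = ∫ x in Set.Ioc t (t + ℓ), v x := fun t _ =>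
    intervalIntegral.integral_of_le (by linarith)
  rw [Finset.sum_congr rfl h1, ← integral_biUnion_finset F (fun _ _ => measurableSet_Ioc),
    intervalIntegral.integral_of_le (by norm_num)]
  · refine setIntegral_mono_set (hv.integrableOn_Ioc) (Filter.Eventually.of_forall hv0) ?_
    refine Filter.Eventually.of_forall ?_
    refine Set.iUnion₂_subset fun t ht => ?_
    have := hF ht
    exact Set.Ioc_subset_Ioc this.1 (by linarith [this.2])
  · intro x hx y hy hxy
    have := hsep hx hy hxy
    rw [Function.onFun, Set.disjoint_left]
    intro z hz1 hz2
    simp only [Set.mem_Ioc] at hz1 hz2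
    rcases le_abs.1 this with h | h <;> linarith
  · exact fun t _ => hv.integrableOn_Ioc

/-- Differentiating in τ multiplies each frequency a by ξa, whence the coefficients `id` and the
factor ξ². One ℓ⁻¹ comes from the mean, the other from splitting the derivative of the squared
modulus. -/
lemma sum_trigEnergy_le {A F : Finset ℝ} {ℓ : ℝ} (hℓ : 0 < ℓ) (hℓ1 : ℓ ≤ 1)
    (hF : (F : Set ℝ) ⊆ Set.Icc 0 1) (hsep : IsSep ℓ (F : Set ℝ)) (ξ : ℝ) :
    ∑ t ∈ F, trigEnergy A 1 (t * ξ) ≤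
      ∫ τ in (0 : ℝ)..2, (2 * ℓ⁻¹ * trigEnergy A 1 (τ * ξ) +
        ℓ * ξ ^ 2 * trigEnergy A id (τ * ξ)) := by
  have hcont : Continuous fun τ : ℝ => 2 * ℓ⁻¹ * trigEnergy A 1 (τ * ξ) +
        ℓ * ξ ^ 2 * trigEnergy A id (τ * ξ) := by fun_prop
  refine le_trans (Finset.sum_le_sum fun t ht => ?_)
    (sum_integral_le_integral_of_isSep hcont (fun x => ?_) hℓ hℓ1 hF hsep)
  swap
  · have := trigEnergy_nonneg A 1 (x * ξ)
    have := trigEnergy_nonneg A id (x * ξ)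
    positivity
  set P : ℝ → ℝ := fun x => ∑ a ∈ A, cos (x * ξ * a) with hP
  set Q : ℝ → ℝ := fun x => ∑ a ∈ A, sin (x * ξ * a) with hQ
  set P' : ℝ → ℝ := fun x => ∑ a ∈ A, a * cos (x * ξ * a) with hP'
  set Q' : ℝ → ℝ := fun x => ∑ a ∈ A, a * sin (x * ξ * a) with hQ'
  have hT : ∀ x, trigEnergy A 1 (x * ξ) = P x ^ 2 + Q x ^ 2 := fun x => by
    simp [trigEnergy_eq_sq_add_sq, hP, hQ]
  have hT' : ∀ x, trigEnergy A id (x * ξ) = P' x ^ 2 + Q' x ^ 2 := fun x => by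
    simp [trigEnergy_eq_sq_add_sq, hP', hQ']
  have hlin : ∀ x a : ℝ, HasDerivAt (fun y => y * ξ * a) (ξ * a) x := fun x a => by
    simpa using ((hasDerivAt_id x).mul_const ξ).mul_const a
  have dP : ∀ x, HasDerivAt P (-ξ * Q' x) x := fun x => by
    refine (HasDerivAt.fun_sum (u := A) fun a _ => (hlin x a).cos).congr_deriv ?_
    rw [hQ', Finset.mul_sum]
    exact Finset.sum_congr rfl fun a _ => by ring
  have dQ : ∀ x, HasDerivAt Q (ξ * P' x) x := fun x => by
    refine (HasDerivAt.fun_sum (u := A) fun a _ => (hlin x a).sin).congr_deriv ?_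
    rw [hP', Finset.mul_sum]
    exact Finset.sum_congr rfl fun a _ => by ring
  have dT : ∀ x, HasDerivAt (fun y => trigEnergy A 1 (y * ξ))
      (2 * ξ * (Q x * P' x - P x * Q' x)) x := fun x => by
    simp_rw [hT]
    refine (((dP x).pow 2).add ((dQ x).pow 2)).congr_deriv ?_
    simp only [Nat.cast_ofNat, Nat.add_one_sub_one, pow_one]
    ring
  have key := le_mean_add_integral_of_hasDerivAt
    (v := fun τ => ℓ⁻¹ * trigEnergy A 1 (τ * ξ) + ℓ * ξ ^ 2 * trigEnergy A id (τ * ξ)) dT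
    (by simp only [hP, hQ, hP', hQ']; fun_prop) (by fun_prop) (fun x => ?_) t hℓ
  · refine key.trans (le_of_eq ?_)
    congr 1; ext x; ring
  -- AM-GM with weight ℓ: |2ξXY| ≤ ℓ⁻¹X² + ℓξ²Y², for the pairs (P, Q') and (Q, P').
  · rw [hT, hT', abs_le]
    have e1 : ℓ⁻¹ * ℓ = 1 := inv_mul_cancel₀ hℓ.ne'
    have hinv : 0 < ℓ⁻¹ := inv_pos.2 hℓ
    have k1 := mul_nonneg hinv.le (sq_nonneg (P x + ℓ * ξ * Q' x))
    have k2 := mul_nonneg hinv.le (sq_nonneg (P x - ℓ * ξ * Q' x))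
    have k3 := mul_nonneg hinv.le (sq_nonneg (Q x + ℓ * ξ * P' x))
    have k4 := mul_nonneg hinv.le (sq_nonneg (Q x - ℓ * ξ * P' x))
    have exp1 : ∀ X Y : ℝ, ℓ⁻¹ * (X + ℓ * ξ * Y) ^ 2 =
        ℓ⁻¹ * X ^ 2 + 2 * ξ * X * Y + ℓ * ξ ^ 2 * Y ^ 2 := fun X Y => by
      field_simp
      ring
    have exp2 : ∀ X Y : ℝ, ℓ⁻¹ * (X - ℓ * ξ * Y) ^ 2 =
        ℓ⁻¹ * X ^ 2 - 2 * ξ * X * Y + ℓ * ξ ^ 2 * Y ^ 2 := fun X Y => by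
      field_simp
      ring
    rw [exp1] at k1 k3
    rw [exp2] at k2 k4
    constructor <;> linarith

end LargeSieve

/-! ### A Kaufman-type transversality integral -/

section KaufmanIntegral

open MeasureTheory Real

/-- If |x| ≥ 4|y|, then |x + τy| ≥ |x|/2 on [0, 2] and the integrand is uniformly small. Otherwise
|y| controls |x|: the bound 1 suffices when |y| ≤ w, and the full Gaussian integral, of size w/|y|,
when |y| > w. -/
lemma integral_exp_neg_sq_linear_le {w : ℝ} (hw : 0 < w) (x y : ℝ) :
    ∫ τ in (0 : ℝ)..2, exp (-(x + τ * y) ^ 2 / w ^ 2) ≤ 12 * (w / (w + |x| + |y|)) := by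
  have hcont : Continuous fun τ : ℝ => exp (-(x + τ * y) ^ 2 / w ^ 2) := by fun_prop
  have hx := abs_nonneg x
  have hy := abs_nonneg y
  have hden : 0 < w + |x| + |y| := by positivity
  have hconst : ∀ K : ℝ, (∀ τ ∈ Set.Icc (0 : ℝ) 2, exp (-(x + τ * y) ^ 2 / w ^ 2) ≤ K) →
      ∫ τ in (0 : ℝ)..2, exp (-(x + τ * y) ^ 2 / w ^ 2) ≤ 2 * K := by
    intro K hK
    refine (intervalIntegral.integral_mono_on (by norm_num) (hcont.intervalIntegrable _ _)
      (continuous_const.intervalIntegrable _ _) hK).trans ?_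
    simp
  rw [← mul_div_assoc, le_div_iff₀ hden]
  rcases le_or_gt (4 * |y|) |x| with h | h
  · have hK : ∀ τ ∈ Set.Icc (0 : ℝ) 2,
        exp (-(x + τ * y) ^ 2 / w ^ 2) ≤ w ^ 2 / (w ^ 2 + (|x| / 2) ^ 2) := by
      intro τ hτ
      have h1 : |x| / 2 ≤ |x + τ * y| := by
        have h2 : |x| ≤ |x + τ * y| + |τ * y| := by
          simpa using abs_sub (x + τ * y) (τ * y)
        rw [abs_mul, abs_of_nonneg hτ.1] at h2
        nlinarith [mul_le_mul_of_nonneg_right hτ.2 hy]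
      have h3 : (|x| / 2) ^ 2 ≤ (x + τ * y) ^ 2 := by
        rw [← sq_abs (x + τ * y)]; gcongr
      rw [neg_div, exp_neg, ← one_div, div_le_div_iff₀ (exp_pos _) (by positivity), one_mul]
      have h4 := add_one_le_exp ((x + τ * y) ^ 2 / w ^ 2)
      have h5 : w ^ 2 * ((x + τ * y) ^ 2 / w ^ 2 + 1) = (x + τ * y) ^ 2 + w ^ 2 := by
        field_simp
      nlinarith [mul_le_mul_of_nonneg_left h4 (sq_nonneg w)]
    refine (mul_le_mul_of_nonneg_right (hconst _ hK) hden.le).trans ?_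
    have h6 : 0 < w ^ 2 + (|x| / 2) ^ 2 := by positivity
    rw [← mul_div_assoc, div_mul_eq_mul_div, div_le_iff₀ h6]
    nlinarith [mul_nonneg hw.le (sq_nonneg (w - |x|)), mul_pos hw hw, mul_nonneg hw.le hx,
      mul_nonneg (mul_nonneg hw.le hw.le) hx, mul_le_mul_of_nonneg_left h (mul_pos hw hw).le,
      mul_nonneg hw.le (sq_nonneg (w - |x| / 2)), mul_nonneg hw.le (sq_nonneg (|x|)),
      pow_pos hw 3]
  · rcases le_or_gt |y| w with hyw | hyw
    · have h1 := hconst 1 fun τ _ => by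
        rw [exp_le_one_iff, neg_div, neg_nonpos]; positivity
      nlinarith
    · have hy0 : 0 < |y| := hw.trans hyw
      have hy1 : y ≠ 0 := abs_pos.1 hy0
      have e : ∀ τ : ℝ, exp (-(x + τ * y) ^ 2 / w ^ 2) =
          exp (-(y ^ 2 / w ^ 2) * (τ + x / y) ^ 2) := fun τ => by
        congr 1; field_simp; ring
      have hb : 0 < y ^ 2 / w ^ 2 := by positivity
      have hI : Integrable fun τ : ℝ => exp (-(x + τ * y) ^ 2 / w ^ 2) := by
        simp_rw [e]
        exact (integrable_exp_neg_mul_sq hb).comp_add_right (x / y)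
      have h1 : ∫ τ in (0 : ℝ)..2, exp (-(x + τ * y) ^ 2 / w ^ 2) ≤
          ∫ τ : ℝ, exp (-(x + τ * y) ^ 2 / w ^ 2) := by
        rw [intervalIntegral.integral_of_le (by norm_num)]
        exact setIntegral_le_integral hI (Filter.Eventually.of_forall fun _ => (exp_pos _).le)
      have h2 : ∫ τ : ℝ, exp (-(x + τ * y) ^ 2 / w ^ 2) = √(π / (y ^ 2 / w ^ 2)) := by
        simp_rw [e]
        rw [integral_add_right_eq_self (fun τ : ℝ => exp (-(y ^ 2 / w ^ 2) * τ ^ 2)),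
          integral_gaussian]
      have h3 : √(π / (y ^ 2 / w ^ 2)) ≤ 2 * w / |y| := by
        rw [sqrt_le_left (by positivity), div_pow, sq_abs, ← div_mul, mul_pow,
          div_mul_eq_mul_div]
        gcongr
        nlinarith [pi_le_four]
      rw [h2] at h1
      refine (mul_le_mul_of_nonneg_right (h1.trans h3) hden.le).trans ?_
      rw [div_mul_eq_mul_div, div_le_iff₀ hy0]
      nlinarith

end KaufmanIntegral

/-! ### The L² energy inequality over separated directions -/

section EnergyInequality

open MeasureTheory Real

/-- The number of pairs of pairs in `A` whose differences `x, y` satisfy `|x + t y| ≤ w`. -/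
noncomputable def energyCount (A : Finset ℝ) (t w : ℝ) : ℕ :=
  (((A ×ˢ A) ×ˢ (A ×ˢ A)).filter
    fun z => |z.1.1 - z.1.2 + t * (z.2.1 - z.2.2)| ≤ w).card

/-- The square-root energy of `A` at scale `w`. -/
noncomputable def rieszSum (A : Finset ℝ) (w : ℝ) : ℝ :=
  ∑ p ∈ A ×ˢ A, √(w / (w + |p.1 - p.2|))

lemma rieszSum_nonneg (A : Finset ℝ) (w : ℝ) : 0 ≤ rieszSum A w :=
  Finset.sum_nonneg fun _ _ => sqrt_nonneg _

lemma energyCount_mono (A : Finset ℝ) (t : ℝ) {w w' : ℝ} (h : w ≤ w') :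
    energyCount A t w ≤ energyCount A t w' :=
  Finset.card_le_card <| Finset.monotone_filter_right _ fun _ _ hz => le_trans hz h

lemma energyCount_le_sum_exp (A : Finset ℝ) (t : ℝ) {w : ℝ} (hw : 0 < w) :
    (energyCount A t w : ℝ) ≤ 3 * ∑ p ∈ A ×ˢ A, ∑ q ∈ A ×ˢ A,
      exp (-(p.1 - p.2 + t * (q.1 - q.2)) ^ 2 / w ^ 2) := by
  rw [energyCount, Finset.card_filter, ← Finset.sum_product', Finset.mul_sum]
  push_cast
  refine Finset.sum_le_sum fun z _ => ?_
  split_ifs with h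
  · have h1 : (z.1.1 - z.1.2 + t * (z.2.1 - z.2.2)) ^ 2 / w ^ 2 ≤ 1 := by
      rw [div_le_one (by positivity), ← sq_abs]
      gcongr
    have h2 : exp (-1) ≤ exp (-(z.1.1 - z.1.2 + t * (z.2.1 - z.2.2)) ^ 2 / w ^ 2) := by
      rw [exp_le_exp, neg_div]; linarith
    have h3 : (1 : ℝ) ≤ 3 * exp (-1) := by
      rw [exp_neg, ← div_eq_mul_inv, le_div_iff₀ (exp_pos _), one_mul]
      exact (exp_one_lt_d9.trans (by norm_num)).le
    linarith
  · positivity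

/-- Since w(w + x + y) ≥ w² and (w + x)(w + y) ≤ (w + x + y)², the Kaufman kernel is at most a
product of square roots, so the double sum factors. -/
lemma sum_integral_exp_le (A : Finset ℝ) {w : ℝ} (hw : 0 < w) :
    ∫ τ in (0 : ℝ)..2, ∑ p ∈ A ×ˢ A, ∑ q ∈ A ×ˢ A,
        (exp (-(p.1 - p.2 + τ * (q.1 - q.2)) ^ 2 / w ^ 2) +
          exp (-(p.1 - p.2 - τ * (q.1 - q.2)) ^ 2 / w ^ 2)) ≤ 24 * rieszSum A w ^ 2 := by
  rw [intervalIntegral.integral_finsetSum fun p _ =>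
    Continuous.intervalIntegrable (by fun_prop) _ _]
  rw [rieszSum, sq (Finset.sum _ _), Finset.sum_mul_sum, Finset.mul_sum]
  refine Finset.sum_le_sum fun p _ => ?_
  rw [intervalIntegral.integral_finsetSum fun p _ =>
    Continuous.intervalIntegrable (by fun_prop) _ _, Finset.mul_sum]
  refine Finset.sum_le_sum fun q _ => ?_
  rw [intervalIntegral.integral_add (Continuous.intervalIntegrable (by fun_prop) _ _)
    (Continuous.intervalIntegrable (by fun_prop) _ _)]
  have h1 := integral_exp_neg_sq_linear_le hw (p.1 - p.2) (q.1 - q.2)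
  have h2 := integral_exp_neg_sq_linear_le hw (p.1 - p.2) (-(q.1 - q.2))
  simp_rw [mul_neg, ← sub_eq_add_neg] at h2
  rw [abs_neg] at h2
  set x := |p.1 - p.2| with hx
  set y := |q.1 - q.2| with hy
  have hx0 : 0 ≤ x := abs_nonneg _
  have hy0 : 0 ≤ y := abs_nonneg _
  have h3 : w / (w + x + y) ≤ √(w / (w + x)) * √(w / (w + y)) := by
    rw [← sqrt_mul (by positivity)]
    refine le_sqrt_of_sq_le ?_
    rw [div_pow, div_mul_div_comm, ← sq]
    gcongr
    nlinarith [mul_nonneg hx0 hy0, mul_nonneg hx0 hw.le, mul_nonneg hy0 hw.le]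
  linarith

/-- Fubini for the trigonometric energy times its dilation mean, against a Gaussian. -/
lemma integral_gaussian_trigEnergy_mean (A : Finset ℝ) {b : ℝ} (hb : 0 < b) :
    ∫ ξ : ℝ, exp (-b * ξ ^ 2) *
        (trigEnergy A 1 ξ * ∫ τ in (0 : ℝ)..2, trigEnergy A 1 (τ * ξ)) =
      ∫ τ in (0 : ℝ)..2, ∫ ξ : ℝ, exp (-b * ξ ^ 2) *
        (trigEnergy A 1 ξ * trigEnergy A 1 (τ * ξ)) := by
  simp_rw [intervalIntegral.integral_of_le (show (0 : ℝ) ≤ 2 by norm_num), ← integral_const_mul]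
  rw [integral_integral_swap]
  have h1 : Integrable (fun z : ℝ × ℝ => exp (-b * z.1 ^ 2) * (1 : ℝ))
      (volume.prod (volume.restrict (Set.Ioc (0 : ℝ) 2))) :=
    (integrable_exp_neg_mul_sq hb).mul_prod (integrable_const (1 : ℝ))
  simp only [mul_one] at h1
  refine Integrable.mul_bdd (c := (A.card : ℝ) ^ 2 * (A.card : ℝ) ^ 2) h1
    (Continuous.aestronglyMeasurable (by fun_prop)) (Filter.Eventually.of_forall fun z => ?_)
  rw [norm_mul]
  exact mul_le_mul (abs_trigEnergy_le (by simp) _) (abs_trigEnergy_le (by simp) _)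
    (norm_nonneg _) (by positivity)

/-- The Gaussian is split into three. Substituting η = τξ uses one factor ξ and the first Gaussian
(as τ ≤ 2, rate 1/8 in ξ dominates rate 1/32 in η); the second absorbs the other ξ at cost 2/w; the
third is kept for the later integration in ξ. -/
lemma sq_mul_exp_mul_integral_trigEnergy_le {A : Finset ℝ} (hA : (A : Set ℝ) ⊆ Set.Icc 0 1)
    {w : ℝ} (hw : 0 < w) (ξ : ℝ) :
    ξ ^ 2 * exp (-(w ^ 2 / 4) * ξ ^ 2) * ∫ τ in (0 : ℝ)..2, trigEnergy A id (τ * ξ) ≤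
      40 / w ^ 2 * gaussianSum A w * exp (-(w ^ 2 / 16) * ξ ^ 2) := by
  wlog hξ : 0 ≤ ξ generalizing ξ
  · have := this (-ξ) (by linarith)
    simpa only [neg_sq, mul_neg, trigEnergy_neg] using this
  set J := ∫ η : ℝ, exp (-(w ^ 2 / 32) * η ^ 2) * trigEnergy A id η with hJ
  have hid : ∀ a ∈ A, (0 : ℝ) ≤ id a ∧ id a ≤ 1 := fun a ha => hA ha
  have hJi : Integrable fun η : ℝ => exp (-(w ^ 2 / 32) * η ^ 2) * trigEnergy A id η :=
    integrable_gaussian_mul_of_bounded (by positivity) (by fun_prop) (abs_trigEnergy_le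
      fun a ha => abs_le.2 ⟨by linarith [(hid a ha).1], (hid a ha).2⟩)
  have hJle : J ≤ 20 / w * gaussianSum A w := by
    refine (integral_gaussian_mul_trigEnergy_le (w := w) (by positivity) (by nlinarith)
      hid).trans (mul_le_mul_of_nonneg_right ?_ (gaussianSum_nonneg _ _))
    rw [sqrt_le_left (by positivity), div_pow, ← div_mul, div_mul_eq_mul_div]
    gcongr
    nlinarith [pi_le_four]
  have h1 : ξ * ∫ τ in (0 : ℝ)..2, exp (-(w ^ 2 / 8) * ξ ^ 2) * trigEnergy A id (τ * ξ) ≤ J := by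
    have h2 : ∫ τ in (0 : ℝ)..2, exp (-(w ^ 2 / 8) * ξ ^ 2) * trigEnergy A id (τ * ξ) ≤
        ∫ τ in (0 : ℝ)..2, exp (-(w ^ 2 / 32) * (τ * ξ) ^ 2) * trigEnergy A id (τ * ξ) := by
      refine intervalIntegral.integral_mono_on (by norm_num)
        (Continuous.intervalIntegrable (by fun_prop) _ _)
        (Continuous.intervalIntegrable (by fun_prop) _ _) fun τ hτ => ?_
      refine mul_le_mul_of_nonneg_right (exp_le_exp.2 ?_) (trigEnergy_nonneg _ _ _)
      have h3 : τ ^ 2 ≤ 2 ^ 2 := pow_le_pow_left₀ hτ.1 hτ.2 2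
      nlinarith [mul_le_mul_of_nonneg_left h3 (by positivity : 0 ≤ w ^ 2 * ξ ^ 2)]
    refine (mul_le_mul_of_nonneg_left h2 hξ).trans ?_
    rw [← smul_eq_mul ξ, intervalIntegral.smul_integral_comp_mul_right
      (fun η => exp (-(w ^ 2 / 32) * η ^ 2) * trigEnergy A id η) ξ,
      intervalIntegral.integral_of_le (by nlinarith)]
    exact setIntegral_le_integral hJi (Filter.Eventually.of_forall fun η =>
      mul_nonneg (exp_pos _).le (trigEnergy_nonneg _ _ _))
  rw [intervalIntegral.integral_const_mul] at h1
  have h4 : ξ * exp (-(w ^ 2 / 16) * ξ ^ 2) ≤ 2 / w := by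
    rw [neg_mul, exp_neg, ← div_eq_mul_inv, div_le_div_iff₀ (exp_pos _) hw]
    have := add_one_le_exp (w ^ 2 / 16 * ξ ^ 2)
    nlinarith [sq_nonneg (w * ξ / 4 - 1), mul_nonneg hξ hw.le]
  have h5 : exp (-(w ^ 2 / 4) * ξ ^ 2) = exp (-(w ^ 2 / 8) * ξ ^ 2) *
      exp (-(w ^ 2 / 16) * ξ ^ 2) * exp (-(w ^ 2 / 16) * ξ ^ 2) := by
    rw [← exp_add, ← exp_add]; congr 1; ring
  have h6 := h1.trans hJle
  have hpos : 0 ≤ ξ * exp (-(w ^ 2 / 16) * ξ ^ 2) := by positivity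
  have hG := gaussianSum_nonneg A w
  calc ξ ^ 2 * exp (-(w ^ 2 / 4) * ξ ^ 2) * ∫ τ in (0 : ℝ)..2, trigEnergy A id (τ * ξ)
      = (ξ * (exp (-(w ^ 2 / 8) * ξ ^ 2) * ∫ τ in (0 : ℝ)..2, trigEnergy A id (τ * ξ))) *
          (ξ * exp (-(w ^ 2 / 16) * ξ ^ 2)) * exp (-(w ^ 2 / 16) * ξ ^ 2) := by
        rw [h5]; ring
    _ ≤ (20 / w * gaussianSum A w) * (2 / w) * exp (-(w ^ 2 / 16) * ξ ^ 2) := by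
        gcongr
    _ = _ := by field_simp; ring

/-- An `L²` bound for the additive energies of the projections of `A × A` to separated
directions: the first term is the low-frequency part, the second the high-frequency part. -/
theorem sum_energyCount_le {A F : Finset ℝ} (hA : (A : Set ℝ) ⊆ Set.Icc 0 1) {ℓ w : ℝ}
    (hℓ : 0 < ℓ) (hℓ1 : ℓ ≤ 1) (hF : (F : Set ℝ) ⊆ Set.Icc 0 1) (hsep : IsSep ℓ (F : Set ℝ))
    (hw : 0 < w) :
    ∑ t ∈ F, (energyCount A t w : ℝ) ≤
      500 * (rieszSum A w ^ 2 / ℓ + ℓ / w ^ 2 * gaussianSum A w ^ 2) := by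
  set b := w ^ 2 / 4 with hb_def
  have hb : 0 < b := by positivity
  have h4b : 4 * b = w ^ 2 := by rw [hb_def]; ring
  have hG : 0 ≤ gaussianSum A w := gaussianSum_nonneg A w
  have hsqrt : √(π / b) = 2 * √π / w := by
    rw [hb_def, sqrt_div pi_pos.le, sqrt_div (sq_nonneg w), sqrt_sq hw.le,
      show (4 : ℝ) = 2 ^ 2 by norm_num, sqrt_sq (by norm_num)]
    field_simp
  have hs0 : 0 < √(π / b) := by positivity
  set X : ℝ → ℝ := fun t =>
    ∫ ξ : ℝ, exp (-b * ξ ^ 2) * (trigEnergy A 1 ξ * trigEnergy A 1 (t * ξ)) with hX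
  have hX_eq := fun t => integral_gaussian_mul_trigEnergy_mul (A := A) hb t
  simp_rw [h4b] at hX_eq
  have hcount : ∀ t, (energyCount A t w : ℝ) ≤ 6 / √(π / b) * X t := by
    intro t
    refine (energyCount_le_sum_exp A t hw).trans ?_
    rw [hX]
    simp only
    rw [hX_eq, ← mul_assoc, show 6 / √(π / b) * (√(π / b) / 2) = 3 by field_simp; norm_num]
    gcongr with p _ q _
    exact le_add_of_nonneg_right (exp_pos _).le
  have hT1 : ∀ x, |trigEnergy A 1 x| ≤ (A.card : ℝ) ^ 2 := fun x => abs_trigEnergy_le (by simp) x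
  have hcontMean : Continuous fun ξ : ℝ => ∫ τ in (0 : ℝ)..2, trigEnergy A 1 (τ * ξ) :=
    intervalIntegral.continuous_parametric_intervalIntegral_of_continuous' (by fun_prop) _ _
  have hint1 : Integrable fun ξ : ℝ => exp (-b * ξ ^ 2) *
      (trigEnergy A 1 ξ * ∫ τ in (0 : ℝ)..2, trigEnergy A 1 (τ * ξ)) := by
    refine integrable_gaussian_mul_of_bounded
      (M := (A.card : ℝ) ^ 2 * ((A.card : ℝ) ^ 2 * |(2 : ℝ) - 0|)) hb (by fun_prop) fun ξ => ?_
    rw [abs_mul]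
    refine mul_le_mul (hT1 _) ?_ (abs_nonneg _) (by positivity)
    rw [← Real.norm_eq_abs]
    exact intervalIntegral.norm_integral_le_of_norm_le_const fun τ _ => by
      rw [Real.norm_eq_abs]; exact hT1 _
  have hint2 : Integrable fun ξ : ℝ => exp (-(w ^ 2 / 16) * ξ ^ 2) * trigEnergy A 1 ξ :=
    integrable_gaussian_mul_of_bounded (by positivity) (by fun_prop) hT1
  have hpt : ∀ ξ : ℝ,
      ∑ t ∈ F, exp (-b * ξ ^ 2) * (trigEnergy A 1 ξ * trigEnergy A 1 (t * ξ)) ≤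
      2 * ℓ⁻¹ * (exp (-b * ξ ^ 2) *
        (trigEnergy A 1 ξ * ∫ τ in (0 : ℝ)..2, trigEnergy A 1 (τ * ξ))) +
      ℓ * (40 / w ^ 2 * gaussianSum A w) *
        (exp (-(w ^ 2 / 16) * ξ ^ 2) * trigEnergy A 1 ξ) := by
    intro ξ
    have h1 := sum_trigEnergy_le (A := A) hℓ hℓ1 hF hsep ξ
    rw [intervalIntegral.integral_add (Continuous.intervalIntegrable (by fun_prop) _ _)
      (Continuous.intervalIntegrable (by fun_prop) _ _), intervalIntegral.integral_const_mul,
      intervalIntegral.integral_const_mul] at h1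
    have h2 := sq_mul_exp_mul_integral_trigEnergy_le hA hw ξ
    rw [← hb_def] at h2
    have hT0 := trigEnergy_nonneg A 1 ξ
    rw [← Finset.mul_sum, ← Finset.mul_sum]
    have h3 := mul_le_mul_of_nonneg_left h1 (mul_nonneg (exp_pos (-b * ξ ^ 2)).le hT0)
    have h4 := mul_le_mul_of_nonneg_left h2 (mul_nonneg hℓ.le hT0)
    linarith
  have hXi : ∀ t, Integrable fun ξ : ℝ =>
      exp (-b * ξ ^ 2) * (trigEnergy A 1 ξ * trigEnergy A 1 (t * ξ)) := fun t =>
    integrable_gaussian_mul_of_bounded (M := (A.card : ℝ) ^ 2 * (A.card : ℝ) ^ 2) hb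
      (by fun_prop) fun ξ => by
        rw [abs_mul]
        exact mul_le_mul (hT1 _) (hT1 _) (abs_nonneg _) (by positivity)
  have hsum : ∑ t ∈ F, X t ≤ 2 * ℓ⁻¹ * (∫ τ in (0 : ℝ)..2, X τ) +
      ℓ * (40 / w ^ 2 * gaussianSum A w) * (8 * √π / w * gaussianSum A w) / 2 := by
    rw [hX]
    simp only
    rw [← integral_finsetSum _ fun t _ => hXi t]
    refine (integral_mono (integrable_finsetSum _ fun t _ => hXi t)
      ((hint1.const_mul _).add (hint2.const_mul _)) hpt).trans ?_
    simp only [Pi.add_apply]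
    rw [integral_add (hint1.const_mul _) (hint2.const_mul _), integral_const_mul,
      integral_const_mul, integral_gaussian_trigEnergy_mean A hb, mul_div_assoc]
    gcongr
    refine (integral_gaussian_mul_trigEnergy_le (w := w) (by positivity) (by nlinarith)
      (by simp)).trans (le_of_eq ?_)
    rw [sqrt_div pi_pos.le, sqrt_div (sq_nonneg w), sqrt_sq hw.le,
      show (16 : ℝ) = 4 ^ 2 by norm_num, sqrt_sq (by norm_num)]
    field_simp; ring
  have hmean : ∫ τ in (0 : ℝ)..2, X τ ≤ √(π / b) / 2 * (24 * rieszSum A w ^ 2) := by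
    rw [hX]
    simp_rw [hX_eq]
    rw [intervalIntegral.integral_const_mul]
    exact mul_le_mul_of_nonneg_left (sum_integral_exp_le A hw) (by positivity)
  have hℓi : 0 < ℓ⁻¹ := inv_pos.2 hℓ
  calc ∑ t ∈ F, (energyCount A t w : ℝ) ≤ ∑ t ∈ F, 6 / √(π / b) * X t :=
        Finset.sum_le_sum fun t _ => hcount t
    _ = 6 / √(π / b) * ∑ t ∈ F, X t := by rw [Finset.mul_sum]
    _ ≤ 6 / √(π / b) * (2 * ℓ⁻¹ * (√(π / b) / 2 * (24 * rieszSum A w ^ 2)) +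
          ℓ * (40 / w ^ 2 * gaussianSum A w) * (8 * √π / w * gaussianSum A w) / 2) := by
        gcongr
        exact hsum.trans (by gcongr)
    _ = 144 * (rieszSum A w ^ 2 / ℓ) + 480 * (ℓ / w ^ 2 * gaussianSum A w ^ 2) := by
        rw [hsqrt]; field_simp; ring
    _ ≤ _ := by
        have : 0 ≤ rieszSum A w ^ 2 / ℓ := by positivity
        have : 0 ≤ ℓ / w ^ 2 * gaussianSum A w ^ 2 := by positivity
        linarith

end EnergyInequality

/-! ### Sums over pairs of a (δ,1/2)-set -/

section Multiscale

open Real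

lemma IsDeltaSet.card_filter_le {C δ : ℝ} {A : Finset ℝ} (hA : IsDeltaSet C δ (1 / 2) A)
    (x : ℝ) {r : ℝ} (hr : δ ≤ r) :
    ((A.filter fun a => |x - a| ≤ r).card : ℝ) ≤ C * √(r / δ) := by
  have h := hA.nonconc x r hr
  have e : (A : Set ℝ) ∩ Metric.closedBall x r = (A.filter fun a => |x - a| ≤ r : Finset ℝ) := by
    ext a
    simp [Metric.mem_closedBall, dist_eq, abs_sub_comm]
  rwa [e, Set.ncard_coe_finset, ← sqrt_eq_rpow] at h

/-- The least admissible k alone suffices: if k > 0 then x > 2^(k-1) w, so w/(w + x) ≤ 4/2^k. -/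
lemma sqrt_div_add_le_sum_indicator {w x : ℝ} (hw : 0 < w) (hx : 0 ≤ x) {K : ℕ}
    (hK : x ≤ 2 ^ K * w) :
    √(w / (w + x)) ≤ ∑ k ∈ Finset.range (K + 1), if x ≤ 2 ^ k * w then 2 / √(2 ^ k) else 0 := by
  classical
  have hex : ∃ k : ℕ, x ≤ 2 ^ k * w := ⟨K, hK⟩
  set k := Nat.find hex with hk
  have hkx : x ≤ 2 ^ k * w := Nat.find_spec hex
  have hkK : k ∈ Finset.range (K + 1) := Finset.mem_range.2 (Nat.lt_succ_of_le (Nat.find_le hK))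
  have h1 := Finset.single_le_sum
    (f := fun k : ℕ => if x ≤ 2 ^ k * w then 2 / √(2 ^ k) else 0)
    (fun j _ => by positivity) hkK
  refine le_trans ?_ h1
  simp only [hkx, if_true]
  rw [sqrt_le_left (by positivity), div_pow, sq_sqrt (by positivity),
    div_le_div_iff₀ (by positivity) (by positivity)]
  rcases Nat.eq_zero_or_pos k with h0 | h0
  · rw [h0]; linarith
  · have h2 : ¬ x ≤ 2 ^ (k - 1) * w := Nat.find_min hex (by omega)
    have h3 : (2 : ℝ) ^ k = 2 * 2 ^ (k - 1) := by
      rw [← pow_succ', Nat.sub_add_cancel h0]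
    rw [h3]
    nlinarith

/-- The kernel exponent 1/2 matches the dimension 1/2, so every dyadic scale contributes equally and
the loss is only the number K + 1 of scales. -/
lemma IsDeltaSet.rieszSum_le {C δ : ℝ} {A : Finset ℝ} (hA : IsDeltaSet C δ (1 / 2) A)
    (hδ : 0 < δ) {w : ℝ} (hw : δ ≤ w) {K : ℕ} (hK : 1 ≤ 2 ^ K * w) :
    rieszSum A w ≤ 2 * (K + 1) * C * A.card * √(w / δ) := by
  have hw0 : 0 < w := hδ.trans_le hw
  have hrow : ∀ a ∈ A, ∑ a' ∈ A, √(w / (w + |a - a'|)) ≤ (K + 1) * (2 * C * √(w / δ)) := by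
    intro a ha
    have h1 : ∀ a' ∈ A, √(w / (w + |a - a'|)) ≤
        ∑ k ∈ Finset.range (K + 1), if |a - a'| ≤ 2 ^ k * w then 2 / √(2 ^ k) else 0 := by
      intro a' ha'
      refine sqrt_div_add_le_sum_indicator hw0 (abs_nonneg _) (le_trans ?_ hK)
      have := hA.subset ha
      have := hA.subset ha'
      simp only [Set.mem_Icc] at *
      rw [abs_le]; constructor <;> linarith
    refine (Finset.sum_le_sum h1).trans ?_
    rw [Finset.sum_comm]
    have h2 : ∀ k ∈ Finset.range (K + 1),
        (∑ a' ∈ A, if |a - a'| ≤ 2 ^ k * w then 2 / √(2 ^ k) else 0) ≤ 2 * C * √(w / δ) := by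
      intro k _
      rw [← Finset.sum_filter, Finset.sum_const, nsmul_eq_mul]
      have h2k : (1 : ℝ) ≤ 2 ^ k := one_le_pow₀ (by norm_num)
      have h3 := hA.card_filter_le a (r := 2 ^ k * w) (by nlinarith)
      refine (mul_le_mul_of_nonneg_right h3 (by positivity)).trans (le_of_eq ?_)
      rw [mul_div_assoc, sqrt_mul (by positivity)]
      have : 0 < √(2 ^ k : ℝ) := by positivity
      field_simp
    refine (Finset.sum_le_sum h2).trans (le_of_eq ?_)
    simp
  rw [rieszSum, Finset.sum_product]
  refine (Finset.sum_le_sum hrow).trans (le_of_eq ?_)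
  rw [Finset.sum_const, nsmul_eq_mul]; ring

lemma gaussianSum_le_rieszSum (A : Finset ℝ) {w : ℝ} (hw : 0 < w) :
    gaussianSum A w ≤ 2 * rieszSum A w := by
  rw [gaussianSum, rieszSum, Finset.mul_sum]
  refine Finset.sum_le_sum fun p _ => ?_
  rw [← sq_abs (p.1 - p.2)]
  set x := |p.1 - p.2|
  have hx : 0 ≤ x := abs_nonneg _
  have h1 : exp (-x ^ 2 / w ^ 2) ≤ w ^ 2 / (w ^ 2 + x ^ 2) := by
    rw [neg_div, exp_neg, ← one_div, div_le_div_iff₀ (exp_pos _) (by positivity), one_mul]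
    have h4 := add_one_le_exp (x ^ 2 / w ^ 2)
    have h5 : w ^ 2 * (x ^ 2 / w ^ 2 + 1) = x ^ 2 + w ^ 2 := by
      field_simp
    nlinarith [mul_le_mul_of_nonneg_left h4 (sq_nonneg w)]
  have h2 : w ^ 2 / (w ^ 2 + x ^ 2) / 2 ≤ w / (w + x) := by
    rw [div_div, div_le_div_iff₀ (by positivity) (by positivity)]
    nlinarith [mul_nonneg hw.le (sq_nonneg (w - x)), mul_nonneg hw.le (sq_nonneg x),
      pow_pos hw 3]
  have h3 : w / (w + x) ≤ √(w / (w + x)) := by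
    have h4 : w / (w + x) ≤ 1 := by rw [div_le_one (by positivity)]; linarith
    refine le_sqrt_of_sq_le ?_
    rw [sq]
    exact mul_le_of_le_one_left (by positivity) h4
  linarith

/-- The number of pairs of points of `A` at distance at most `r`. -/
noncomputable def closePairs (A : Finset ℝ) (r : ℝ) : Finset (ℝ × ℝ) :=
  (A ×ˢ A).filter fun p => |p.1 - p.2| ≤ r

lemma gaussianSum_le_card_closePairs (A : Finset ℝ) {w r : ℝ} (hr : 0 ≤ r) :
    gaussianSum A w ≤ (closePairs A r).card + (A.card : ℝ) ^ 2 * exp (-r ^ 2 / w ^ 2) := by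
  have e : (closePairs A r).card + (A.card : ℝ) ^ 2 * exp (-r ^ 2 / w ^ 2) =
      ∑ p ∈ A ×ˢ A, ((if |p.1 - p.2| ≤ r then 1 else 0) + exp (-r ^ 2 / w ^ 2)) := by
    rw [Finset.sum_add_distrib, closePairs, Finset.card_filter]
    simp [sq]
  rw [e, gaussianSum]
  refine Finset.sum_le_sum fun p _ => ?_
  split_ifs with h
  · have h1 : exp (-(p.1 - p.2) ^ 2 / w ^ 2) ≤ 1 := by
      rw [exp_le_one_iff, neg_div, neg_nonpos]; positivity
    linarith [exp_pos (-r ^ 2 / w ^ 2)]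
  · rw [zero_add, exp_le_exp]
    refine div_le_div_of_nonneg_right (neg_le_neg ?_) (sq_nonneg _)
    rw [← sq_abs (p.1 - p.2)]
    exact pow_le_pow_left₀ hr (not_le.1 h).le 2

end Multiscale

/-! ### From small covering numbers to many collisions -/

section CauchySchwarz

lemma sq_card_le_card_mul_card_collisions {α β : Type*} [DecidableEq β] (S : Finset α)
    (B : Finset β) (f : α → β) (hf : ∀ x ∈ S, f x ∈ B) :
    S.card ^ 2 ≤ B.card * ((S ×ˢ S).filter fun z => f z.1 = f z.2).card := by
  have h1 : S.card = ∑ b ∈ B, (S.filter fun x => f x = b).card :=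
    Finset.card_eq_sum_card_fiberwise hf
  have h2 : ((S ×ˢ S).filter fun z => f z.1 = f z.2).card =
      ∑ b ∈ B, (S.filter fun x => f x = b).card ^ 2 := by
    rw [Finset.card_eq_sum_card_fiberwise (f := fun z => f z.1) (t := B)]
    · refine Finset.sum_congr rfl fun b _ => ?_
      rw [sq, ← Finset.card_product]
      congr 1
      ext z
      simp only [Finset.mem_filter, Finset.mem_product]
      grind
    · intro z hz
      rw [Finset.mem_coe, Finset.mem_filter, Finset.mem_product] at hz
      exact hf _ hz.1.1
  rw [h2]
  nth_rewrite 1 [h1]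
  exact sq_sum_le_card_mul_sum_sq

/-- A δ-separated subset of maximal cardinality is a δ-net. -/
lemma exists_cover_of_not_containsSep {X : Set ℝ} (hX : X.Finite) {δ N : ℝ} (hδ : 0 < δ)
    (h : ¬ ContainsSep X δ N) :
    ∃ B : Finset ℝ, (B.card : ℝ) < N ∧ ∀ x ∈ X, ∃ b ∈ B, |x - b| < δ := by
  classical
  set 𝓕 : Finset (Finset ℝ) :=
    hX.toFinset.powerset.filter fun B : Finset ℝ => IsSep δ (B : Set ℝ) with h𝓕
  have hne : 𝓕.Nonempty := ⟨∅, by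
    rw [h𝓕, Finset.mem_filter]
    exact ⟨Finset.empty_mem_powerset _, by simp [IsSep]⟩⟩
  obtain ⟨B, hB, hmax⟩ := Finset.exists_max_image 𝓕 Finset.card hne
  rw [h𝓕, Finset.mem_filter, Finset.mem_powerset] at hB
  have hBX : (B : Set ℝ) ⊆ X := fun x hx => hX.mem_toFinset.1 (hB.1 hx)
  refine ⟨B, ?_, fun x hx => ?_⟩
  · by_contra! hN
    exact h ⟨B, hBX, hB.2, hN⟩
  · by_contra! hfar
    have hxB : x ∉ B := fun hxB => by
      have := hfar x hxB
      simp only [sub_self, abs_zero] at this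
      linarith
    have hins : insert x B ∈ 𝓕 := by
      rw [h𝓕, Finset.mem_filter, Finset.mem_powerset]
      refine ⟨Finset.insert_subset (hX.mem_toFinset.2 hx) hB.1, ?_⟩
      rw [Finset.coe_insert, IsSep]
      refine hB.2.insert fun b hb _ => ⟨hfar b hb, ?_⟩
      rw [abs_sub_comm]; exact hfar b hb
    have := hmax _ hins
    rw [Finset.card_insert_of_notMem hxB] at this
    omega

variable {A B : Finset ℝ} {δ t : ℝ}

lemma card_pow_four_le (hB : ∀ a ∈ A, ∀ b ∈ A, ∃ c ∈ B, |a + t * b - c| < δ) :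
    A.card ^ 4 ≤ B.card * energyCount A t (2 * δ) := by
  classical
  choose! φ hφB hφ using hB
  have h := sq_card_le_card_mul_card_collisions (A ×ˢ A) B (fun p => φ p.1 p.2) fun p hp => by
    rw [Finset.mem_product] at hp
    exact hφB _ hp.1 _ hp.2
  rw [Finset.card_product, ← sq, ← pow_mul] at h
  refine h.trans (Nat.mul_le_mul_left _ ?_)
  refine Finset.card_le_card_of_injOn (fun z => ((z.1.1, z.2.1), (z.1.2, z.2.2))) ?_ ?_
  · rintro ⟨⟨a, b⟩, ⟨a', b'⟩⟩ hz
    simp only [Finset.coe_filter, Finset.mem_product, Set.mem_ofPred_eq] at hz ⊢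
    obtain ⟨⟨⟨ha, hb⟩, ha', hb'⟩, he⟩ := hz
    refine ⟨⟨⟨ha, ha'⟩, hb, hb'⟩, ?_⟩
    have h1 := abs_lt.1 (hφ a ha b hb)
    have h2 := abs_lt.1 (hφ a' ha' b' hb')
    rw [← he] at h2
    rw [abs_le]
    constructor <;> nlinarith
  · rintro ⟨⟨a, b⟩, ⟨a', b'⟩⟩ _ ⟨⟨c, d⟩, ⟨c', d'⟩⟩ _ h
    simp only [Prod.mk.injEq] at h ⊢
    tauto

/-- A collision of (a, a', b) with (c, c', d) gives |a - c + t(b - d)| ≤ 2r + 2δ ≤ 4r, an energy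
quadruple at scale 4r. Given that quadruple, a' lies within r of a, and then c' within 2δ of a' + tb
- td; the two non-concentration bounds count these choices. -/
lemma IsDeltaSet.sq_card_mul_closePairs_le {C r : ℝ} (hA : IsDeltaSet C δ (1 / 2) A)
    (hδ : 0 < δ) (hC : 0 ≤ C) (hr : δ ≤ r)
    (hB : ∀ a ∈ A, ∀ b ∈ A, ∃ c ∈ B, |a + t * b - c| < δ) :
    ((A.card : ℝ) * (closePairs A r).card) ^ 2 ≤
      B.card * (energyCount A t (4 * r) * (C * √(r / δ) * (C * √2))) := by
  classical
  choose! φ hφB hφ using hB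
  set S := closePairs A r ×ˢ A with hS
  have hmem : ∀ x ∈ S, (x.1.1 ∈ A ∧ x.1.2 ∈ A ∧ |x.1.1 - x.1.2| ≤ r) ∧ x.2 ∈ A := by
    intro x hx
    simpa [hS, closePairs, Finset.mem_product, and_assoc] using hx
  have h := sq_card_le_card_mul_card_collisions S B (fun x => φ x.1.2 x.2) fun x hx =>
    hφB _ (hmem x hx).1.2.1 _ (hmem x hx).2
  have hcard : ((S.card : ℕ) : ℝ) = (A.card : ℝ) * (closePairs A r).card := by
    rw [hS, Finset.card_product]; push_cast; ring
  rw [← hcard]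
  have h' : (S.card : ℝ) ^ 2 ≤
      B.card * ((S ×ˢ S).filter fun z => φ z.1.1.2 z.1.2 = φ z.2.1.2 z.2.2).card := by
    exact_mod_cast h
  refine h'.trans (mul_le_mul_of_nonneg_left ?_ (Nat.cast_nonneg _))
  set Q := ((A ×ˢ A) ×ˢ (A ×ˢ A)).filter
    fun z => |z.1.1 - z.1.2 + t * (z.2.1 - z.2.2)| ≤ 4 * r with hQ
  set U := Q.sigma fun z => (A.filter fun a => |z.1.1 - a| ≤ r).sigma
    fun a => A.filter fun a' => |a + t * z.2.1 - t * z.2.2 - a'| ≤ 2 * δ with hU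
  have hle : ((S ×ˢ S).filter fun z => φ z.1.1.2 z.1.2 = φ z.2.1.2 z.2.2).card ≤ U.card := by
    refine Finset.card_le_card_of_injOn
      (fun z => ⟨((z.1.1.1, z.2.1.1), (z.1.2, z.2.2)), ⟨z.1.1.2, z.2.1.2⟩⟩) ?_ ?_
    · intro z hz
      rw [Finset.mem_coe, Finset.mem_filter, Finset.mem_product] at hz
      obtain ⟨⟨hz1, hz2⟩, he⟩ := hz
      obtain ⟨⟨ha, ha', har⟩, hb⟩ := hmem _ hz1
      obtain ⟨⟨hc, hc', hcr⟩, hd⟩ := hmem _ hz2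
      have h1 := abs_lt.1 (hφ _ ha' _ hb)
      have h2 := abs_lt.1 (hφ _ hc' _ hd)
      rw [← he] at h2
      have h3 := abs_le.1 har
      have h4 := abs_le.1 hcr
      simp only [hU, hQ, Finset.coe_sigma, Set.mem_sigma_iff, Finset.mem_coe,
        Finset.mem_filter, Finset.mem_product]
      refine ⟨⟨⟨⟨ha, hc⟩, hb, hd⟩, ?_⟩, ⟨ha', har⟩, hc', ?_⟩
      · rw [abs_le]; constructor <;> linarith
      · rw [abs_le]; constructor <;> linarith
    · rintro ⟨⟨⟨a, a'⟩, b⟩, ⟨⟨c, c'⟩, d⟩⟩ _ ⟨⟨⟨x, x'⟩, y⟩, ⟨⟨z, z'⟩, u⟩⟩ _ h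
      simp only [Sigma.mk.injEq, Prod.mk.injEq, heq_eq_eq] at h ⊢
      tauto
  refine (Nat.cast_le.2 hle).trans ?_
  rw [hU, Finset.card_sigma, energyCount]
  push_cast
  rw [← hQ, ← nsmul_eq_mul]
  refine Finset.sum_le_card_nsmul _ _ _ fun z _ => ?_
  rw [Finset.card_sigma]
  push_cast
  have h5 : ∀ a ∈ A.filter (fun a => |z.1.1 - a| ≤ r),
      ((A.filter fun a' => |a + t * z.2.1 - t * z.2.2 - a'| ≤ 2 * δ).card : ℝ) ≤ C * √2 := by
    intro a _
    have := hA.card_filter_le (a + t * z.2.1 - t * z.2.2) (r := 2 * δ) (by linarith)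
    rwa [mul_div_cancel_right₀ _ hδ.ne'] at this
  refine (Finset.sum_le_card_nsmul _ _ _ h5).trans ?_
  rw [nsmul_eq_mul]
  exact mul_le_mul_of_nonneg_right (hA.card_filter_le _ hr) (by positivity)

end CauchySchwarz

/-! ### Contradiction from two scales -/

section Projections

open Real

/-- If few directions are lost, small projections of `A × A` in all directions of `F` force `A`
to have many pairs at distance at most `D`. -/
lemma card_closePairs_lower {C D g δ : ℝ} {A F : Finset ℝ} {K : ℕ} (hC : 1 ≤ C) (hD : 0 < D)
    (hD1 : D ≤ 1) (hg : 0 < g) (hδ : δ = D * g ^ 20) (hA : IsDeltaSet C δ (1 / 2) A)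
    (hcard : δ⁻¹ ≤ C ^ 2 * (A.card : ℝ) ^ 2) (hF : (F : Set ℝ) ⊆ Set.Icc 0 1)
    (hsep : IsSep (C⁻¹ * D) (F : Set ℝ)) (hFcard : C⁻¹ * (g / D) ≤ F.card)
    (hproj : ∀ t ∈ F, ∃ B : Finset ℝ, (B.card : ℝ) < D⁻¹ ∧
      ∀ a ∈ A, ∀ b ∈ A, ∃ c ∈ B, |a + t * b - c| < δ)
    (hK : δ⁻¹ ≤ 2 ^ K) (hg17 : 2 * g ^ 17 ≤ 1)
    (hsmall : 4000 * C ^ 6 * ((K : ℝ) + 1) ^ 2 * g ^ 2 ≤ 1)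
    (hexp : exp (-2 / g ^ 6) ≤ δ / (4000 * C)) :
    (A.card : ℝ) ^ 4 * (D * g ^ 7) ≤ 4000 * C * ((closePairs A D).card : ℝ) ^ 2 := by
  set n : ℝ := (A.card : ℝ) with hn
  set L : ℝ := (K : ℝ) + 1 with hL
  -- The factor g^3 beats the loss g in |F| by g², which absorbs the logarithms; by `hexp`, the
  -- Gaussian at scale w is negligible beyond distance D.
  set w := D * g ^ 3 with hw
  have hw0 : 0 < w := by positivity
  have hδ0 : 0 < δ := by rw [hδ]; positivity
  have hC0 : 0 < C := by linarith
  have hg1 : g ≤ 1 := by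
    by_contra! h
    have := one_le_pow₀ h.le (n := 17)
    linarith
  have hδw : 2 * δ ≤ w := by
    have : 0 < D * g ^ 3 := by positivity
    rw [hδ, hw]
    nlinarith
  have hKw : 1 ≤ 2 ^ K * w := by
    rw [inv_le_iff_one_le_mul₀ hδ0] at hK
    have : (0 : ℝ) < 2 ^ K := by positivity
    nlinarith
  have hn0 : 0 ≤ n := Nat.cast_nonneg _
  have hR := hA.rieszSum_le hδ0 (by linarith) hKw
  have hR2 : rieszSum A w ^ 2 ≤ 4 * L ^ 2 * C ^ 4 * n ^ 4 * w := by
    refine (pow_le_pow_left₀ (rieszSum_nonneg _ _) hR 2).trans ?_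
    rw [mul_pow, sq_sqrt (by positivity), div_eq_mul_inv]
    have := mul_le_mul_of_nonneg_left hcard (by positivity : 0 ≤ 4 * L ^ 2 * C ^ 2 * n ^ 2 * w)
    nlinarith
  have hℓ1 : C⁻¹ * D ≤ 1 := mul_le_one₀ (inv_le_one_of_one_le₀ hC) hD.le hD1
  have hmain := sum_energyCount_le (A := A) hA.subset (by positivity) hℓ1 hF hsep hw0
  have hlow : (F.card : ℝ) * (n ^ 4 * D) ≤ ∑ t ∈ F, (energyCount A t w : ℝ) := by
    rw [← nsmul_eq_mul]
    refine Finset.card_nsmul_le_sum _ _ _ fun t ht => ?_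
    obtain ⟨B, hB, hcov⟩ := hproj t ht
    have h1 : n ^ 4 ≤ B.card * energyCount A t (2 * δ) := by
      rw [hn]
      exact_mod_cast card_pow_four_le hcov
    have h2 : (energyCount A t (2 * δ) : ℝ) ≤ energyCount A t w :=
      Nat.cast_le.2 (energyCount_mono A t hδw)
    have h3 : n ^ 4 ≤ D⁻¹ * energyCount A t w :=
      h1.trans (mul_le_mul hB.le h2 (Nat.cast_nonneg _) (by positivity))
    rwa [inv_mul_eq_div, le_div_iff₀ hD] at h3
  have hlow2 : C⁻¹ * g * n ^ 4 ≤ (F.card : ℝ) * (n ^ 4 * D) := by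
    refine le_trans (le_of_eq ?_)
      (mul_le_mul_of_nonneg_right hFcard (by positivity : 0 ≤ n ^ 4 * D))
    field_simp
  set G := gaussianSum A w with hG
  have hG0 : 0 ≤ G := gaussianSum_nonneg _ _
  have h1 : C⁻¹ * g * n ^ 4 ≤
      500 * (4 * L ^ 2 * C ^ 5 * n ^ 4 * g ^ 3 + C⁻¹ / (D * g ^ 6) * G ^ 2) := by
    refine (hlow2.trans (hlow.trans hmain)).trans ?_
    have e1 : rieszSum A w ^ 2 / (C⁻¹ * D) ≤ 4 * L ^ 2 * C ^ 5 * n ^ 4 * g ^ 3 := by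
      rw [div_le_iff₀ (by positivity)]
      refine hR2.trans (le_of_eq ?_)
      rw [hw]; field_simp
    have e2 : C⁻¹ * D / w ^ 2 = C⁻¹ / (D * g ^ 6) := by rw [hw]; field_simp
    rw [e2]
    linarith
  have h2 : n ^ 4 * (D * g ^ 7) ≤ 1000 * G ^ 2 := by
    have h3 := mul_le_mul_of_nonneg_left h1 (by positivity : 0 ≤ C * (D * g ^ 6))
    have e1 : C * (D * g ^ 6) * (C⁻¹ * g * n ^ 4) = n ^ 4 * (D * g ^ 7) := by field_simp
    have e2 : C * (D * g ^ 6) *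
        (500 * (4 * L ^ 2 * C ^ 5 * n ^ 4 * g ^ 3 + C⁻¹ / (D * g ^ 6) * G ^ 2)) =
        (4000 * C ^ 6 * L ^ 2 * g ^ 2) * (n ^ 4 * (D * g ^ 7)) / 2 + 500 * G ^ 2 := by
      field_simp; ring
    rw [e1, e2] at h3
    have := mul_le_mul_of_nonneg_right hsmall (by positivity : 0 ≤ n ^ 4 * (D * g ^ 7))
    linarith
  have h4 : G ≤ (closePairs A D).card + n ^ 2 * exp (-D ^ 2 / w ^ 2) :=
    gaussianSum_le_card_closePairs A hD.le
  have h5 : exp (-D ^ 2 / w ^ 2) ^ 2 ≤ D * g ^ 7 / (4000 * C) := by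
    have e1 : exp (-D ^ 2 / w ^ 2) ^ 2 = exp (-2 / g ^ 6) := by
      rw [← exp_nat_mul]; congr 1; rw [hw]; field_simp; norm_num
    rw [e1]
    refine hexp.trans (div_le_div_of_nonneg_right ?_ (by positivity))
    rw [hδ]
    exact mul_le_mul_of_nonneg_left (pow_le_pow_of_le_one hg.le hg1 (by norm_num)) hD.le
  set P : ℝ := ((closePairs A D).card : ℝ) with hP
  set X := exp (-D ^ 2 / w ^ 2) with hX
  have h6 : G ^ 2 ≤ 2 * P ^ 2 + 2 * (n ^ 4 * X ^ 2) := by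
    refine (pow_le_pow_left₀ hG0 h4 2).trans ?_
    have e : 2 * P ^ 2 + 2 * (n ^ 4 * X ^ 2) - (P + n ^ 2 * X) ^ 2 = (P - n ^ 2 * X) ^ 2 := by ring
    linarith [sq_nonneg (P - n ^ 2 * X)]
  have h7 : n ^ 4 * X ^ 2 ≤ n ^ 4 * (D * g ^ 7) / 4000 := by
    rw [mul_div_assoc]
    refine mul_le_mul_of_nonneg_left (h5.trans ?_) (by positivity)
    exact div_le_div_of_nonneg_left (by positivity) (by norm_num) (by linarith)
  have h8 : n ^ 4 * (D * g ^ 7) ≤ 4000 * P ^ 2 := by linarith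
  refine h8.trans ?_
  exact mul_le_mul_of_nonneg_right (by linarith) (sq_nonneg _)

/-- Some direction of `F` has nearly minimal energy at scale `4 D`. -/
lemma exists_energyCount_le {C D g δ : ℝ} {A F : Finset ℝ} {K : ℕ} (hC : 1 ≤ C) (hD : 0 < D)
    (hD1 : D ≤ 1) (hg : 0 < g) (hg1 : g ≤ 1) (hδ : δ = D * g ^ 20)
    (hA : IsDeltaSet C δ (1 / 2) A)
    (hcard : δ⁻¹ ≤ C ^ 2 * (A.card : ℝ) ^ 2) (hF : (F : Set ℝ) ⊆ Set.Icc 0 1)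
    (hsep : IsSep (C⁻¹ * D) (F : Set ℝ)) (hFcard : C⁻¹ * (g / D) ≤ F.card)
    (hK : δ⁻¹ ≤ 2 ^ K) :
    ∃ t ∈ F, (energyCount A t (4 * D) : ℝ) * g ≤
      10000 * C ^ 6 * ((K : ℝ) + 1) ^ 2 * (A.card : ℝ) ^ 4 * D := by
  set n : ℝ := (A.card : ℝ) with hn
  set L : ℝ := (K : ℝ) + 1 with hL
  have hw0 : 0 < 4 * D := by positivity
  have hδ0 : 0 < δ := by rw [hδ]; positivity
  have hC0 : 0 < C := by linarith
  have hδw : δ ≤ 4 * D := by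
    have := pow_le_one₀ hg.le hg1 (n := 20)
    rw [hδ]
    nlinarith
  have hKw : 1 ≤ 2 ^ K * (4 * D) := by
    rw [inv_le_iff_one_le_mul₀ hδ0] at hK
    have : (0 : ℝ) < 2 ^ K := by positivity
    nlinarith
  have hn0 : 0 ≤ n := Nat.cast_nonneg _
  have hR0 := rieszSum_nonneg A (4 * D)
  have hR := hA.rieszSum_le hδ0 hδw hKw
  have hR2 : rieszSum A (4 * D) ^ 2 ≤ 16 * L ^ 2 * C ^ 4 * n ^ 4 * D := by
    refine (pow_le_pow_left₀ hR0 hR 2).trans ?_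
    rw [mul_pow, sq_sqrt (by positivity), div_eq_mul_inv]
    have := mul_le_mul_of_nonneg_left hcard
      (by positivity : 0 ≤ 16 * L ^ 2 * C ^ 2 * n ^ 2 * D)
    nlinarith
  have hG2 : gaussianSum A (4 * D) ^ 2 ≤ 4 * rieszSum A (4 * D) ^ 2 := by
    refine (pow_le_pow_left₀ (gaussianSum_nonneg _ _) (gaussianSum_le_rieszSum A hw0) 2).trans ?_
    exact le_of_eq (by ring)
  have hℓ1 : C⁻¹ * D ≤ 1 := mul_le_one₀ (inv_le_one_of_one_le₀ hC) hD.le hD1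
  have hmain := sum_energyCount_le (A := A) hA.subset (by positivity) hℓ1 hF hsep hw0
  have hupper : ∑ t ∈ F, (energyCount A t (4 * D) : ℝ) ≤ 10000 * C ^ 5 * L ^ 2 * n ^ 4 := by
    refine hmain.trans ?_
    have e1 : rieszSum A (4 * D) ^ 2 / (C⁻¹ * D) ≤ 16 * L ^ 2 * C ^ 5 * n ^ 4 := by
      rw [div_le_iff₀ (by positivity)]
      refine hR2.trans (le_of_eq ?_)
      field_simp
    have e2 : C⁻¹ * D / (4 * D) ^ 2 * gaussianSum A (4 * D) ^ 2 ≤ 4 * L ^ 2 * C ^ 5 * n ^ 4 := by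
      have h1 : C⁻¹ * D / (4 * D) ^ 2 ≤ 1 / (16 * D) := by
        rw [div_le_div_iff₀ (by positivity) (by positivity)]
        have := inv_le_one_of_one_le₀ hC
        nlinarith [mul_pos hD hD]
      refine (mul_le_mul h1 (hG2.trans (mul_le_mul_of_nonneg_left hR2 (by norm_num)))
        (sq_nonneg _) (by positivity)).trans ?_
      have h2 : C ^ 4 ≤ C ^ 5 := pow_le_pow_right₀ hC (by norm_num)
      have h3 : 1 / (16 * D) * (4 * (16 * L ^ 2 * C ^ 4 * n ^ 4 * D)) =
          4 * L ^ 2 * C ^ 4 * n ^ 4 := by field_simp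
      rw [h3]
      gcongr
    linarith
  have hFpos : (0 : ℝ) < F.card := lt_of_lt_of_le (by positivity) hFcard
  have hFne : F.Nonempty := Finset.card_pos.1 (by exact_mod_cast hFpos)
  obtain ⟨t, ht, hmin⟩ := Finset.exists_min_image F (fun t => energyCount A t (4 * D)) hFne
  refine ⟨t, ht, ?_⟩
  have h1 : (F.card : ℝ) * energyCount A t (4 * D) ≤ 10000 * C ^ 5 * L ^ 2 * n ^ 4 := by
    refine le_trans ?_ hupper
    rw [← nsmul_eq_mul]
    exact Finset.card_nsmul_le_sum _ _ _ fun x hx => Nat.cast_le.2 (hmin x hx)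
  have h2 := (mul_le_mul_of_nonneg_right hFcard
    (Nat.cast_nonneg (energyCount A t (4 * D)))).trans h1
  have h3 := mul_le_mul_of_nonneg_left h2 (by positivity : 0 ≤ C * D)
  calc (energyCount A t (4 * D) : ℝ) * g =
        C * D * (C⁻¹ * (g / D) * energyCount A t (4 * D)) := by field_simp
    _ ≤ C * D * (10000 * C ^ 5 * L ^ 2 * n ^ 4) := h3
    _ = _ := by ring

/-- The exponents are balanced as 20 = 7 + 11 + 2: g^7 from the lower bound for close pairs, g^11
from the upper bound (g from the energy, g^10 from √(D/δ)), and g² left to beat L² and the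
constants. -/
theorem exists_large_projection {C D g δ : ℝ} {A F : Finset ℝ} {K : ℕ} (hC : 1 ≤ C)
    (hD : 0 < D) (hD1 : D ≤ 1) (hg : 0 < g) (hδ : δ = D * g ^ 20)
    (hA : IsDeltaSet C δ (1 / 2) A) (hcard : δ⁻¹ ≤ C ^ 2 * (A.card : ℝ) ^ 2)
    (hF : (F : Set ℝ) ⊆ Set.Icc 0 1) (hsep : IsSep (C⁻¹ * D) (F : Set ℝ))
    (hFcard : C⁻¹ * (g / D) ≤ F.card) (hK : δ⁻¹ ≤ 2 ^ K) (hg17 : 2 * g ^ 17 ≤ 1)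
    (hsmall : 200000000 * C ^ 11 * (((K : ℝ) + 1) ^ 2 * g ^ 2) < 1)
    (hexp : exp (-2 / g ^ 6) ≤ δ / (4000 * C)) :
    ∃ t ∈ F, ContainsSep ((A : Set ℝ) + t • (A : Set ℝ)) δ D⁻¹ := by
  by_contra! hcon
  have hδ0 : 0 < δ := by rw [hδ]; positivity
  have hC0 : 0 < C := by linarith
  have hg1 : g ≤ 1 := by
    by_contra! h
    have := one_le_pow₀ h.le (n := 17)
    linarith
  have hδD : δ ≤ D := by
    rw [hδ]; exact mul_le_of_le_one_right hD.le (pow_le_one₀ hg.le hg1)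
  have hproj : ∀ t ∈ F, ∃ B : Finset ℝ, (B.card : ℝ) < D⁻¹ ∧
      ∀ a ∈ A, ∀ b ∈ A, ∃ c ∈ B, |a + t * b - c| < δ := by
    intro t ht
    have hfin : ((A : Set ℝ) + t • (A : Set ℝ)).Finite :=
      A.finite_toSet.add (A.finite_toSet.smul_set)
    obtain ⟨B, hB, hcov⟩ := exists_cover_of_not_containsSep hfin hδ0 (hcon t ht)
    exact ⟨B, hB, fun a ha b hb => hcov _ (Set.add_mem_add ha (Set.smul_mem_smul_set hb))⟩
  set n : ℝ := (A.card : ℝ) with hn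
  set L : ℝ := (K : ℝ) + 1 with hL
  have hsmall' : 4000 * C ^ 6 * L ^ 2 * g ^ 2 ≤ 1 := by
    have h1 : C ^ 6 ≤ C ^ 11 := pow_le_pow_right₀ hC (by norm_num)
    have h2 := mul_le_mul_of_nonneg_right h1 (by positivity : 0 ≤ L ^ 2 * g ^ 2)
    have h3 : 0 ≤ C ^ 11 * (L ^ 2 * g ^ 2) := by positivity
    linarith
  have hP := card_closePairs_lower hC hD hD1 hg hδ hA hcard hF hsep hFcard hproj hK hg17 hsmall'
    hexp
  obtain ⟨t, ht, hE⟩ := exists_energyCount_le hC hD hD1 hg hg1 hδ hA hcard hF hsep hFcard hK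
  obtain ⟨B, hB, hcov⟩ := hproj t ht
  have hCS := hA.sq_card_mul_closePairs_le hδ0 hC0.le hδD hcov
  rw [← hn] at hP hE hCS
  set P : ℝ := ((closePairs A D).card : ℝ) with hPdef
  set Q : ℝ := (energyCount A t (4 * D) : ℝ) with hQ
  have hQ0 : 0 ≤ Q := Nat.cast_nonneg _
  have hsq : √(D / δ) = (g ^ 10)⁻¹ := by
    have : D / δ = ((g ^ 10)⁻¹) ^ 2 := by rw [hδ]; field_simp
    rw [this, sqrt_sq (by positivity)]
  have h2 : √2 ≤ 2 := by rw [sqrt_le_left] <;> norm_num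
  have h1 : (n * P) ^ 2 ≤ D⁻¹ * (Q * (C * (g ^ 10)⁻¹ * (C * 2))) := by
    refine hCS.trans ?_
    rw [hsq]
    gcongr
  have hn2 : 0 < n ^ 2 := by
    have : 0 < C ^ 2 * n ^ 2 := lt_of_lt_of_le (inv_pos.2 hδ0) hcard
    exact pos_of_mul_pos_right this (by positivity)
  have h3 : n ^ 2 * P ^ 2 * g ^ 11 ≤ 20000 * C ^ 8 * L ^ 2 * n ^ 4 := by
    calc n ^ 2 * P ^ 2 * g ^ 11 = (n * P) ^ 2 * g ^ 11 := by ring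
      _ ≤ D⁻¹ * (Q * (C * (g ^ 10)⁻¹ * (C * 2))) * g ^ 11 := by gcongr
      _ = 2 * C ^ 2 * D⁻¹ * (Q * g) := by field_simp
      _ ≤ 2 * C ^ 2 * D⁻¹ * (10000 * C ^ 6 * L ^ 2 * n ^ 4 * D) := by gcongr
      _ = _ := by field_simp; ring
  have h4 : n ^ 2 * (D * g ^ 18) ≤ 80000000 * C ^ 9 * L ^ 2 := by
    have h5 : n ^ 4 * (n ^ 2 * (D * g ^ 18)) ≤ n ^ 4 * (80000000 * C ^ 9 * L ^ 2) := by
      calc n ^ 4 * (n ^ 2 * (D * g ^ 18)) = n ^ 2 * g ^ 11 * (n ^ 4 * (D * g ^ 7)) := by ring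
        _ ≤ n ^ 2 * g ^ 11 * (4000 * C * P ^ 2) := by gcongr
        _ = 4000 * C * (n ^ 2 * P ^ 2 * g ^ 11) := by ring
        _ ≤ 4000 * C * (20000 * C ^ 8 * L ^ 2 * n ^ 4) := by gcongr
        _ = _ := by ring
    exact le_of_mul_le_mul_left h5 (by nlinarith)
  have h6 : 1 ≤ C ^ 2 * n ^ 2 * (D * g ^ 20) := by
    rw [← hδ]
    rwa [inv_le_iff_one_le_mul₀ hδ0] at hcard
  have h7 : C ^ 2 * n ^ 2 * (D * g ^ 20) ≤ 80000000 * C ^ 11 * (L ^ 2 * g ^ 2) := by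
    calc C ^ 2 * n ^ 2 * (D * g ^ 20) = C ^ 2 * g ^ 2 * (n ^ 2 * (D * g ^ 18)) := by ring
      _ ≤ C ^ 2 * g ^ 2 * (80000000 * C ^ 9 * L ^ 2) := by gcongr
      _ = _ := by ring
  have h8 : 0 ≤ C ^ 11 * (L ^ 2 * g ^ 2) := by positivity
  linarith

end Projections

/-! ### Smallness conditions as δ tends to 0 -/

section Asymptotics

open Real Filter Topology

lemma exists_nat_inv_le_two_pow {δ : ℝ} (hδ : 0 < δ) (hδ1 : δ ≤ 1) :
    ∃ K : ℕ, δ⁻¹ ≤ 2 ^ K ∧ (K : ℝ) + 1 ≤ 2 - 2 * log δ := by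
  have hlog : log δ ≤ 0 := log_nonpos hδ.le hδ1
  -- The factor 2 suffices because log 2 ≥ 1/2.
  refine ⟨⌈-2 * log δ⌉₊, ?_, ?_⟩
  · have h1 := Nat.le_ceil (-2 * log δ)
    rw [← log_le_log_iff (inv_pos.2 hδ) (by positivity), log_inv, log_pow]
    have h2 : (1 : ℝ) / 2 ≤ log 2 := by linarith [log_two_gt_d9]
    nlinarith
  · have := Nat.ceil_lt_add_one (show 0 ≤ -2 * log δ by linarith)
    linarith

lemma tendsto_log_sq_mul_rpow {ε : ℝ} (hε : 0 < ε) :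
    Tendsto (fun δ : ℝ => (2 - 2 * log δ) ^ 2 * (δ ^ ε) ^ 2) (𝓝[>] 0) (𝓝 0) := by
  have h1 := tendsto_log_mul_rpow_nhdsGT_zero hε
  have h2 : Tendsto (fun δ : ℝ => δ ^ ε) (𝓝[>] 0) (𝓝 0) := by
    have : ContinuousAt (fun δ : ℝ => δ ^ ε) 0 := continuousAt_rpow_const _ _ (Or.inr hε.le)
    have h3 := this.tendsto
    rw [zero_rpow hε.ne'] at h3
    exact h3.mono_left nhdsWithin_le_nhds
  have h4 := ((h2.const_mul 2).sub (h1.const_mul 2)).pow 2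
  simp only [mul_zero, sub_zero, ne_eq, OfNat.ofNat_ne_zero, not_false_eq_true, zero_pow] at h4
  refine h4.congr fun δ => ?_
  ring

lemma tendsto_exp_neg_div_rpow {ε : ℝ} (hε : 0 < ε) :
    Tendsto (fun δ : ℝ => exp (-2 / (δ ^ ε) ^ 6) / δ) (𝓝[>] 0) (𝓝 0) := by
  have h1 := tendsto_rpow_mul_exp_neg_mul_atTop_nhds_zero (1 / (6 * ε)) 2 (by norm_num)
  have h2 : Tendsto (fun δ : ℝ => δ ^ (-(6 * ε))) (𝓝[>] 0) atTop :=
    tendsto_rpow_neg_nhdsGT_zero (by linarith)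
  refine (h1.comp h2).congr' ?_
  filter_upwards [self_mem_nhdsWithin] with δ hδ
  have hδ0 : (0 : ℝ) < δ := hδ
  simp only [Function.comp]
  have e1 : (δ ^ (-(6 * ε))) ^ (1 / (6 * ε)) = δ⁻¹ := by
    rw [← rpow_mul hδ0.le, show -(6 * ε) * (1 / (6 * ε)) = -1 by field_simp, rpow_neg_one]
  have e2 : -2 / (δ ^ ε) ^ 6 = -2 * δ ^ (-(6 * ε)) := by
    rw [rpow_neg hδ0.le, div_eq_mul_inv, ← rpow_natCast (δ ^ ε) 6, ← rpow_mul hδ0.le]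
    congr 3
    push_cast
    ring
  rw [e1, e2]
  ring

end Asymptotics

/-- The number `σ` depends on `s` only; `δ₀` and `c` depend on `s` and on the constant `C` which
quantifies the hypotheses. -/
theorem theorem1p3 (s : ℝ) (hs : 1 / 2 ≤ s) (hs' : s < 2 - Real.sqrt 2) :
    ∃ σ : ℝ, σ < s ∧
      ∀ C : ℝ, 1 ≤ C →
        ∃ δ₀ : ℝ, 0 < δ₀ ∧ ∃ c : ℝ, 0 < c ∧
          ∀ δ : ℝ, 0 < δ → δ ≤ δ₀ →
            ∀ A : Finset ℝ, IsDeltaSet C δ (1 / 2) A →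
              C⁻¹ * δ ^ (-(1 / 2) : ℝ) ≤ (A.card : ℝ) →
              (A.card : ℝ) ≤ C * δ ^ (-(1 / 2) : ℝ) →
              ∀ E : Set ℝ, E ⊆ Set.Icc 0 1 →
                ContainsSep E (C⁻¹ * δ ^ s) (C⁻¹ * δ ^ (-σ)) →
                ∃ t ∈ E, ContainsSep ((A : Set ℝ) + t • (A : Set ℝ)) δ (c * δ ^ (-s)) := by
  have hs1 : s < 1 := by
    have : 1 ≤ Real.sqrt 2 := Real.one_le_sqrt.2 (by norm_num)
    linarith
  -- This makes δ = δ^s (δ^ε)^20; positivity of ε comes from s < 1.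
  set ε := (1 - s) / 20 with hε
  have hε0 : 0 < ε := by rw [hε]; linarith
  refine ⟨s - ε, by linarith, fun C hC => ?_⟩
  have hC0 : 0 < C := by linarith
  have ev1 := (tendsto_log_sq_mul_rpow hε0).eventually_lt_const
    (show (0 : ℝ) < 1 / (200000000 * C ^ 11) by positivity)
  have ev2 := (tendsto_exp_neg_div_rpow hε0).eventually_lt_const
    (show (0 : ℝ) < 1 / (4000 * C) by positivity)
  obtain ⟨δ₁, hδ₁, hev⟩ := mem_nhdsGT_iff_exists_Ioc_subset.1 (ev1.and ev2)
  refine ⟨min δ₁ (1 / 2), lt_min hδ₁ (by norm_num), 1, one_pos, ?_⟩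
  intro δ hδ hδle A hA hAcard _ E hE hEsep
  obtain ⟨F, hFE, hFsep, hFcard⟩ := hEsep
  obtain ⟨h1, h2⟩ := hev ⟨hδ, hδle.trans (min_le_left _ _)⟩
  have hδ1 : δ ≤ 1 := (hδle.trans (min_le_right _ _)).trans (by norm_num)
  obtain ⟨K, hK, hKlog⟩ := exists_nat_inv_le_two_pow hδ hδ1
  have hg0 : 0 < δ ^ ε := Real.rpow_pos_of_pos hδ _
  have hprod : δ = δ ^ s * (δ ^ ε) ^ 20 := by
    rw [← Real.rpow_natCast (δ ^ ε) 20, ← Real.rpow_mul hδ.le, ← Real.rpow_add hδ,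
      show s + ε * ((20 : ℕ) : ℝ) = 1 by rw [hε]; push_cast; ring, Real.rpow_one]
  have hL : ((K : ℝ) + 1) ^ 2 * (δ ^ ε) ^ 2 ≤ (2 - 2 * Real.log δ) ^ 2 * (δ ^ ε) ^ 2 := by
    gcongr
  have hsmall : 200000000 * C ^ 11 * (((K : ℝ) + 1) ^ 2 * (δ ^ ε) ^ 2) < 1 := by
    have := hL.trans_lt h1
    rwa [lt_div_iff₀ (by positivity), mul_comm] at this
  have hg17 : 2 * (δ ^ ε) ^ 17 ≤ 1 := by
    -- Already implied by `hsmall`, whose other factors are large.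
    have hg2 : (δ ^ ε) ^ 2 * 4 ≤ 1 := by
      have hC11 : 1 ≤ C ^ 11 := one_le_pow₀ hC
      have hL1 : 1 ≤ ((K : ℝ) + 1) ^ 2 := one_le_pow₀ (by linarith [Nat.cast_nonneg (α := ℝ) K])
      nlinarith [mul_le_mul hC11 hL1 zero_le_one (by positivity), sq_nonneg (δ ^ ε)]
    have hg1 : δ ^ ε ≤ 1 / 2 := by nlinarith
    have := pow_le_pow_left₀ hg0.le hg1 17
    norm_num at this
    linarith
  have hexp : Real.exp (-2 / (δ ^ ε) ^ 6) ≤ δ / (4000 * C) := by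
    rw [div_lt_iff₀ hδ] at h2
    exact h2.le.trans (le_of_eq (by ring))
  have hcard : δ⁻¹ ≤ C ^ 2 * (A.card : ℝ) ^ 2 := by
    have h3 : δ ^ (-(1 / 2) : ℝ) ≤ C * A.card := by
      rwa [inv_mul_le_iff₀ hC0] at hAcard
    have h4 := pow_le_pow_left₀ (Real.rpow_nonneg hδ.le _) h3 2
    rw [← Real.rpow_natCast, ← Real.rpow_mul hδ.le, mul_pow] at h4
    norm_num at h4
    rwa [Real.rpow_neg_one] at h4
  have hFcard' : C⁻¹ * (δ ^ ε / δ ^ s) ≤ F.card := by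
    rwa [← Real.rpow_sub hδ, show ε - s = -(s - ε) by ring]
  obtain ⟨t, ht, hsepA⟩ := exists_large_projection hC (Real.rpow_pos_of_pos hδ s)
    (Real.rpow_le_one hδ.le hδ1 (by linarith)) hg0 hprod hA hcard (hFE.trans hE) hFsep hFcard'
    hK hg17 hsmall hexp
  refine ⟨t, hFE ht, ?_⟩
  rwa [one_mul, Real.rpow_neg hδ.le]
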